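/- Let $d\ge 1$ be any integer, let $\Omega\subset\mathbb{R}^d$ be a bounded open set (for instance a bounded domain with Lipschitz boundary), let $T>0$, $\nu>0$, $Q:=(0,T)\times\Omega$ and $\Gamma_D:=(0,T)\times\partial\Omega$. All functions are complex-valued, $(u,v):=\int_Q u\,\overline{v}$ is the scalar product of $L^2(Q)$, and $S:=i\partial_t-\nu\Delta$, where $\Delta$ is the Laplacian in the space variables. Put $$D_0:=\{\varphi\in C_0^\infty(\mathbb{R}^{d+1}):\varphi=0\text{ on }\Gamma_D\cup(\{0\}\times\Omega)\},\qquad D_T:=\{\psi\in C_0^\infty(\mathbb{R}^{d+1}):\psi=0\text{ on }\Gamma_D\cup(\{T\}\times\Omega)\}.$$ Let $$V:=\{v\in L^2(Q): Sv\in L^2(Q)\text{ and }(S\psi,v)-(\psi,Sv)=0\ \text{ for all }\psi\in D_T\},\qquad \|v\|_V^2:=\|v\|_{L^2(Q)}^2+\|Sv\|_{L^2(Q)}^2,$$ where $Sv$ is taken in the sense of distributions on $Q$. Regard $S$ as an unbounded, densely defined operator on $L^2(Q)$ with domain $V$, and let $S^*$ be its adjoint, with domain $V^*\subset L^2(Q)$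 normed by $\|w\|_{V^*}^2:=\|w\|_{L^2(Q)}^2+\|S^*w\|_{L^2(Q)}^2$. Assume that (the restrictions to $Q$ of the functions in) $D_0$ are dense in $V$ for $\|\cdot\|_V$ and that $D_T$ is dense in $V^*$ for $\|\cdot\|_{V^*}$. Then $S:V\to L^2(Q)$ is a continuous bijection. Hence the space-time variational problem is well posed: for every $f\in L^2(Q)$ there is exactly one $u\in V$ with $$\int_Q (Su)\,\overline{w}=\int_Q f\,\overline{w}\qquad\text{for all } w\in L^2(Q),$$ and there is a constant $C$, independent of $f$, such that $\|u\|_V\le C\,\|f\|_{L^2(Q)}$. -/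

import Mathlib

open MeasureTheory Set
open scoped ContDiff ComplexConjugate

noncomputable section

namespace SchrodingerST

/-! ### Graph spaces of unbounded operators -/

section GraphSpace

variable {H : Type*} [NormedAddCommGroup H] [InnerProductSpace ℂ H]

/-- The domain of an unbounded operator `A` on `H`, as a space of its own, which carries the
graph norm `‖v‖² = ‖v‖_H² + ‖A v‖_H²` (and not the norm of `H`). -/
def GraphSpace (A : H →ₗ.[ℂ] H) : Type _ := A.domain

namespace GraphSpace

variable (A : H →ₗ.[ℂ] H)

instance : AddCommGroup (GraphSpace A) := inferInstanceAs (AddCommGroup A.domain)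

instance : Module ℂ (GraphSpace A) := inferInstanceAs (Module ℂ A.domain)

/-- The inclusion of the domain of `A` in `H`. -/
def incl : GraphSpace A →ₗ[ℂ] H := A.domain.subtype

/-- The operator `A`, as an everywhere defined linear map on its domain. -/
def op : GraphSpace A →ₗ[ℂ] H := A.toFun

/-- The map `v ↦ (v, A v)` to the Hilbert sum of two copies of `H`. -/
def toGraph : GraphSpace A →ₗ[ℂ] WithLp 2 (H × H) :=
  (WithLp.linearEquiv 2 ℂ (H × H)).symm.toLinearMap ∘ₗ (incl A).prod (op A)

theorem toGraph_injective : Function.Injective (toGraph A) := by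
  intro v w h
  have h1 : incl A v = incl A w :=
    congrArg (fun z : WithLp 2 (H × H) => (WithLp.ofLp z).1) h
  exact Subtype.ext h1

instance : NormedAddCommGroup (GraphSpace A) :=
  NormedAddCommGroup.induced (GraphSpace A) (WithLp 2 (H × H)) (toGraph A) (toGraph_injective A)

instance : NormedSpace ℂ (GraphSpace A) :=
  NormedSpace.induced ℂ (GraphSpace A) (WithLp 2 (H × H)) (toGraph A)

theorem norm_sq_eq (v : GraphSpace A) : ‖v‖ ^ 2 = ‖incl A v‖ ^ 2 + ‖op A v‖ ^ 2 :=
  WithLp.prod_norm_sq_eq_of_L2 (toGraph A v)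

end GraphSpace

end GraphSpace

/-! ### Smooth functions on space-time -/

/-- Space-time `ℝ × ℝᵈ`, with points `(t, x)`. -/
abbrev SpaceTime (d : ℕ) : Type := ℝ × EuclideanSpace ℝ (Fin d)

variable {d : ℕ}

/-- The time derivative `∂ₜ φ`. -/
def timeDeriv (φ : SpaceTime d → ℂ) (p : SpaceTime d) : ℂ := fderiv ℝ φ p (1, 0)

/-- The partial derivative of `φ` with respect to the `j`-th space variable. -/
def spaceDeriv (j : Fin d) (φ : SpaceTime d → ℂ) (p : SpaceTime d) : ℂ :=
  fderiv ℝ φ p (0, EuclideanSpace.single j 1)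

/-- The Laplacian `Δ φ = ∑ⱼ ∂ⱼ ∂ⱼ φ` in the space variables. -/
def spaceLaplacian (φ : SpaceTime d → ℂ) (p : SpaceTime d) : ℂ :=
  ∑ j : Fin d, spaceDeriv j (spaceDeriv j φ) p

/-- `S φ = i ∂ₜ φ - ν Δ φ` for a smooth function `φ`. -/
def smoothS (ν : ℝ) (φ : SpaceTime d → ℂ) (p : SpaceTime d) : ℂ :=
  Complex.I * timeDeriv φ p - (ν : ℂ) * spaceLaplacian φ p

/-- The transpose `-i ∂ₜ χ - ν Δ χ` of `S` for the bilinear pairing of distributions with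
test functions. -/
def smoothSTranspose (ν : ℝ) (χ : SpaceTime d → ℂ) (p : SpaceTime d) : ℂ :=
  -Complex.I * timeDeriv χ p - (ν : ℂ) * spaceLaplacian χ p

/-- The space `C₀^∞(ℝ^{d+1})` of smooth complex functions with compact support. -/
def SmoothCompact (d : ℕ) : Set (SpaceTime d → ℂ) :=
  {φ | ContDiff ℝ ∞ φ ∧ HasCompactSupport φ}

/-- The space-time cylinder `Q = (0, T) × Ω`. -/
def cylinder (T : ℝ) (Ω : Set (EuclideanSpace ℝ (Fin d))) : Set (SpaceTime d) :=
  Ioo 0 T ×ˢ Ω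

/-- `D₀`: the `φ ∈ C₀^∞(ℝ^{d+1})` that vanish on `((0, T) × ∂Ω) ∪ ({0} × Ω)`. -/
def D₀ (T : ℝ) (Ω : Set (EuclideanSpace ℝ (Fin d))) : Set (SpaceTime d → ℂ) :=
  {φ | φ ∈ SmoothCompact d ∧ ∀ p ∈ (Ioo 0 T ×ˢ frontier Ω) ∪ ({0} ×ˢ Ω), φ p = 0}

/-- `D_T`: the `ψ ∈ C₀^∞(ℝ^{d+1})` that vanish on `((0, T) × ∂Ω) ∪ ({T} × Ω)`. -/
def D_T (T : ℝ) (Ω : Set (EuclideanSpace ℝ (Fin d))) : Set (SpaceTime d → ℂ) :=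
  {ψ | ψ ∈ SmoothCompact d ∧ ∀ p ∈ (Ioo 0 T ×ˢ frontier Ω) ∪ ({T} ×ˢ Ω), ψ p = 0}

/-! ### The Schrödinger operator on `L²(Q)` -/

/-- The complex Hilbert space `L²(Q)`. -/
abbrev L2 (T : ℝ) (Ω : Set (EuclideanSpace ℝ (Fin d))) : Type :=
  Lp ℂ 2 ((volume : Measure (SpaceTime d)).restrict (cylinder T Ω))

/-- `S v = g` in the sense of distributions on `Q`, for `v, g ∈ L²(Q)`. -/
def IsWeakS (ν T : ℝ) (Ω : Set (EuclideanSpace ℝ (Fin d))) (v g : L2 T Ω) : Prop :=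
  ∀ χ ∈ SmoothCompact d, tsupport χ ⊆ cylinder T Ω →
    ∫ p in cylinder T Ω, v p * smoothSTranspose ν χ p = ∫ p in cylinder T Ω, g p * χ p

/-- For `g = S v`: the condition `(S ψ, v) - (ψ, S v) = 0` for all `ψ ∈ D_T`, with the scalar
product `(a, b) = ∫_Q a * conj b`. -/
def BoundaryCondition (ν T : ℝ) (Ω : Set (EuclideanSpace ℝ (Fin d))) (v g : L2 T Ω) : Prop :=
  ∀ ψ ∈ D_T T Ω,
    (∫ p in cylinder T Ω, smoothS ν ψ p * conj (v p)) -
      ∫ p in cylinder T Ω, ψ p * conj (g p) = 0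

theorem contDiff_timeDeriv {φ : SpaceTime d → ℂ} (h : ContDiff ℝ ∞ φ) :
    ContDiff ℝ ∞ (timeDeriv φ) :=
  (h.fderiv_right (m := ∞) (by simp)).clm_apply contDiff_const

theorem contDiff_spaceDeriv {φ : SpaceTime d → ℂ} (h : ContDiff ℝ ∞ φ) (j : Fin d) :
    ContDiff ℝ ∞ (spaceDeriv j φ) :=
  (h.fderiv_right (m := ∞) (by simp)).clm_apply contDiff_const

theorem hasCompactSupport_timeDeriv {φ : SpaceTime d → ℂ} (h : HasCompactSupport φ) :
    HasCompactSupport (timeDeriv φ) :=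
  h.fderiv_apply (𝕜 := ℝ) _

theorem hasCompactSupport_spaceDeriv {φ : SpaceTime d → ℂ} (h : HasCompactSupport φ)
    (j : Fin d) : HasCompactSupport (spaceDeriv j φ) :=
  h.fderiv_apply (𝕜 := ℝ) _

theorem spaceLaplacian_mem {φ : SpaceTime d → ℂ} (h : φ ∈ SmoothCompact d) :
    spaceLaplacian φ ∈ SmoothCompact d := by
  have e : spaceLaplacian φ = ∑ j : Fin d, spaceDeriv j (spaceDeriv j φ) := by
    ext p; simp [spaceLaplacian]
  refine ⟨?_, ?_⟩
  · unfold spaceLaplacian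
    exact ContDiff.sum fun j _ => contDiff_spaceDeriv (contDiff_spaceDeriv h.1 j) j
  · rw [e]
    refine Finset.sum_induction _ HasCompactSupport (fun _ _ => HasCompactSupport.add)
      HasCompactSupport.zero fun j _ =>
        hasCompactSupport_spaceDeriv (hasCompactSupport_spaceDeriv h.2 j) j

theorem combination_mem {φ : SpaceTime d → ℂ} (h : φ ∈ SmoothCompact d) (a b : ℂ) :
    (fun p => a * timeDeriv φ p - b * spaceLaplacian φ p) ∈ SmoothCompact d := by
  have hl := spaceLaplacian_mem h
  have h1 : HasCompactSupport fun p => a * timeDeriv φ p :=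
    (hasCompactSupport_timeDeriv h.2).mul_left (f := fun _ => a)
  have h2 : HasCompactSupport fun p => b * spaceLaplacian φ p :=
    hl.2.mul_left (f := fun _ => b)
  refine ⟨(contDiff_const.mul (contDiff_timeDeriv h.1)).sub (contDiff_const.mul hl.1), ?_⟩
  exact h1.sub h2

theorem smoothS_mem (ν : ℝ) {φ : SpaceTime d → ℂ} (h : φ ∈ SmoothCompact d) :
    smoothS ν φ ∈ SmoothCompact d :=
  combination_mem h _ _

theorem smoothSTranspose_mem (ν : ℝ) {φ : SpaceTime d → ℂ} (h : φ ∈ SmoothCompact d) :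
    smoothSTranspose ν φ ∈ SmoothCompact d :=
  combination_mem h _ _

theorem memLp_of_mem {φ : SpaceTime d → ℂ} (h : φ ∈ SmoothCompact d)
    (μ : Measure (SpaceTime d)) [IsFiniteMeasureOnCompacts μ] : MemLp φ 2 μ :=
  h.1.continuous.memLp_of_hasCompactSupport h.2

theorem integrable_mul {T : ℝ} {Ω : Set (EuclideanSpace ℝ (Fin d))} (v : L2 T Ω)
    {φ : SpaceTime d → ℂ} (h : φ ∈ SmoothCompact d) :
    Integrable (fun p => v p * φ p) (volume.restrict (cylinder T Ω)) :=
  (Lp.memLp v).integrable_mul (memLp_of_mem h _)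

theorem integrable_mul_conj {T : ℝ} {Ω : Set (EuclideanSpace ℝ (Fin d))} (v : L2 T Ω)
    {φ : SpaceTime d → ℂ} (h : φ ∈ SmoothCompact d) :
    Integrable (fun p => φ p * conj (v p)) (volume.restrict (cylinder T Ω)) :=
  (memLp_of_mem h _).integrable_mul (Lp.memLp v).star

theorem integral_mul_add {T : ℝ} {Ω : Set (EuclideanSpace ℝ (Fin d))} (v w : L2 T Ω)
    {φ : SpaceTime d → ℂ} (h : φ ∈ SmoothCompact d) :
    ∫ p in cylinder T Ω, (v + w) p * φ p =
      (∫ p in cylinder T Ω, v p * φ p) + ∫ p in cylinder T Ω, w p * φ p := by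
  rw [← integral_add (integrable_mul v h) (integrable_mul w h)]
  refine integral_congr_ae ?_
  filter_upwards [Lp.coeFn_add v w] with p hp
  rw [hp, Pi.add_apply, add_mul]

theorem integral_mul_smul {T : ℝ} {Ω : Set (EuclideanSpace ℝ (Fin d))} (c : ℂ) (v : L2 T Ω)
    (φ : SpaceTime d → ℂ) :
    ∫ p in cylinder T Ω, (c • v) p * φ p = c * ∫ p in cylinder T Ω, v p * φ p := by
  rw [← integral_const_mul]
  refine integral_congr_ae ?_
  filter_upwards [Lp.coeFn_smul c v] with p hp
  rw [hp, Pi.smul_apply, smul_eq_mul, mul_assoc]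

theorem integral_conj_add {T : ℝ} {Ω : Set (EuclideanSpace ℝ (Fin d))} (v w : L2 T Ω)
    {φ : SpaceTime d → ℂ} (h : φ ∈ SmoothCompact d) :
    ∫ p in cylinder T Ω, φ p * conj ((v + w) p) =
      (∫ p in cylinder T Ω, φ p * conj (v p)) + ∫ p in cylinder T Ω, φ p * conj (w p) := by
  rw [← integral_add (integrable_mul_conj v h) (integrable_mul_conj w h)]
  refine integral_congr_ae ?_
  filter_upwards [Lp.coeFn_add v w] with p hp
  rw [hp, Pi.add_apply, map_add, mul_add]

theorem integral_conj_smul {T : ℝ} {Ω : Set (EuclideanSpace ℝ (Fin d))} (c : ℂ) (v : L2 T Ω)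
    (φ : SpaceTime d → ℂ) :
    ∫ p in cylinder T Ω, φ p * conj ((c • v) p) =
      conj c * ∫ p in cylinder T Ω, φ p * conj (v p) := by
  rw [← integral_const_mul]
  refine integral_congr_ae ?_
  filter_upwards [Lp.coeFn_smul c v] with p hp
  rw [hp, Pi.smul_apply, smul_eq_mul, map_mul]
  ring

/-- The pairs `(v, S v)` with `v, S v ∈ L²(Q)`, `S v` taken in the sense of distributions on `Q`,
such that `(S ψ, v) - (ψ, S v) = 0` for all `ψ ∈ D_T`. -/
def schrodingerGraph (ν T : ℝ) (Ω : Set (EuclideanSpace ℝ (Fin d))) :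
    Submodule ℂ (L2 T Ω × L2 T Ω) where
  carrier := {z | IsWeakS ν T Ω z.1 z.2 ∧ BoundaryCondition ν T Ω z.1 z.2}
  zero_mem' := by
    refine ⟨fun χ _ _ => ?_, fun ψ _ => ?_⟩
    · have h := integral_mul_smul (0 : ℂ) (0 : L2 T Ω) (smoothSTranspose ν χ)
      have h' := integral_mul_smul (0 : ℂ) (0 : L2 T Ω) χ
      simp only [zero_smul, zero_mul] at h h'
      exact h.trans h'.symm
    · have h := integral_conj_smul (0 : ℂ) (0 : L2 T Ω) (smoothS ν ψ)
      have h' := integral_conj_smul (0 : ℂ) (0 : L2 T Ω) ψ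
      simp only [zero_smul, map_zero, zero_mul] at h h'
      exact sub_eq_zero.2 (h.trans h'.symm)
  add_mem' := by
    rintro ⟨v, g⟩ ⟨w, k⟩ ⟨h1, h2⟩ ⟨h3, h4⟩
    refine ⟨fun χ hχ hs => ?_, fun ψ hψ => ?_⟩
    · have e1 := h1 χ hχ hs
      have e2 := h3 χ hχ hs
      simp only [Prod.mk_add_mk]
      rw [integral_mul_add v w (smoothSTranspose_mem ν hχ),
        integral_mul_add g k hχ]
      simp only at e1 e2
      rw [e1, e2]
    · have e1 := sub_eq_zero.1 (h2 ψ hψ)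
      have e2 := sub_eq_zero.1 (h4 ψ hψ)
      simp only [Prod.mk_add_mk]
      rw [integral_conj_add v w (smoothS_mem ν hψ.1),
        integral_conj_add g k hψ.1]
      simp only at e1 e2
      rw [e1, e2, sub_self]
  smul_mem' := by
    rintro c ⟨v, g⟩ ⟨h1, h2⟩
    refine ⟨fun χ hχ hs => ?_, fun ψ hψ => ?_⟩
    · have e1 := h1 χ hχ hs
      simp only [Prod.smul_mk]
      rw [integral_mul_smul, integral_mul_smul]
      simp only at e1
      rw [e1]
    · have e1 := sub_eq_zero.1 (h2 ψ hψ)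
      simp only [Prod.smul_mk]
      rw [integral_conj_smul, integral_conj_smul]
      simp only at e1
      rw [e1, sub_self]

/-- The unbounded operator `S = i ∂ₜ - ν Δ : 𝒱 ⊂ L²(Q) → L²(Q)`. Its domain `𝒱` consists of the
`v ∈ L²(Q)` with `S v ∈ L²(Q)` and `(S ψ, v) - (ψ, S v) = 0` for all `ψ ∈ D_T`. -/
def schrodinger (ν T : ℝ) (Ω : Set (EuclideanSpace ℝ (Fin d))) : L2 T Ω →ₗ.[ℂ] L2 T Ω :=
  (schrodingerGraph ν T Ω).toLinearPMap

/-- Distributional values in `L²(Q)` are unique, so that `schrodingerGraph` is the graph of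
`schrodinger`. -/
theorem schrodinger_graph_eq (ν T : ℝ) {Ω : Set (EuclideanSpace ℝ (Fin d))} (hΩ : IsOpen Ω) :
    (schrodinger ν T Ω).graph = schrodingerGraph ν T Ω := by
  refine Submodule.toLinearPMap_graph_eq _ ?_
  rintro ⟨v, g⟩ ⟨h, -⟩ hv
  simp only at hv
  subst hv
  have hQ : IsOpen (cylinder T Ω) := isOpen_Ioo.prod hΩ
  have h0 : ∀ χ ∈ SmoothCompact d, tsupport χ ⊆ cylinder T Ω →
      ∫ p in cylinder T Ω, g p * χ p = 0 := by
    intro χ hχ hs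
    have e := h χ hχ hs
    have h' := integral_mul_smul (0 : ℂ) (0 : L2 T Ω) (smoothSTranspose ν χ)
    simp only [zero_smul, zero_mul] at h'
    exact e.symm.trans h'
  have hl : LocallyIntegrableOn g (cylinder T Ω) (volume.restrict (cylinder T Ω)) :=
    ((Lp.memLp g).locallyIntegrable (by norm_num)).locallyIntegrableOn _
  have hz := hQ.ae_eq_zero_of_integral_contDiff_smul_eq_zero hl (by
    intro f hf hc hs
    have hm : (fun p => ((f p : ℝ) : ℂ)) ∈ SmoothCompact d :=
      ⟨Complex.ofRealCLM.contDiff.comp hf, hc.comp_left (g := Complex.ofReal) rfl⟩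
    have := h0 _ hm ((tsupport_comp_subset (g := Complex.ofReal) rfl f).trans hs)
    rw [← this]
    refine integral_congr_ae (Filter.Eventually.of_forall fun p => ?_)
    simp [mul_comm])
  refine Lp.eq_zero_iff_ae_eq_zero.2 ?_
  filter_upwards [hz, ae_restrict_mem hQ.measurableSet] with p hp hp'
  exact hp hp'

/-- The space `𝒱` with the norm `‖v‖² = ‖v‖²_{L²(Q)} + ‖S v‖²_{L²(Q)}`. -/
abbrev V (ν T : ℝ) (Ω : Set (EuclideanSpace ℝ (Fin d))) : Type :=
  GraphSpace (schrodinger ν T Ω)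

/-- The domain `𝒱*` of the adjoint `S*` of the densely defined operator `S`, with the norm
`‖w‖² = ‖w‖²_{L²(Q)} + ‖S* w‖²_{L²(Q)}`. -/
abbrev VAdj (ν T : ℝ) (Ω : Set (EuclideanSpace ℝ (Fin d))) : Type :=
  GraphSpace (schrodinger ν T Ω).adjoint

/-- The elements of the graph space of `A` that are the restriction to `Q` of a function in `D`. -/
def restrictions {T : ℝ} {Ω : Set (EuclideanSpace ℝ (Fin d))} (A : L2 T Ω →ₗ.[ℂ] L2 T Ω)
    (D : Set (SpaceTime d → ℂ)) : Set (GraphSpace A) :=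
  {v | ∃ φ ∈ D, ⇑(GraphSpace.incl A v) =ᵐ[volume.restrict (cylinder T Ω)] φ}

/-- The density assumption: `D₀` is dense in `𝒱` and `D_T` is dense in `𝒱*`. -/
def DensityAssumption (ν T : ℝ) (Ω : Set (EuclideanSpace ℝ (Fin d))) : Prop :=
  Dense (restrictions (schrodinger ν T Ω) (D₀ T Ω)) ∧
    Dense (restrictions (schrodinger ν T Ω).adjoint (D_T T Ω))

/-- The operator `S : 𝒱 → L²(Q)`. -/
def S (ν T : ℝ) (Ω : Set (EuclideanSpace ℝ (Fin d))) : V ν T Ω →ₗ[ℂ] L2 T Ω :=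
  GraphSpace.op (schrodinger ν T Ω)

/-- The sesquilinear form `𝒜(v, w) = ∫_Q (S v) * conj w` on `𝒱 × L²(Q)`. -/
def formA (ν T : ℝ) (Ω : Set (EuclideanSpace ℝ (Fin d))) (v : V ν T Ω) (w : L2 T Ω) : ℂ :=
  ∫ p in cylinder T Ω, S ν T Ω v p * conj (w p)

/-- The functional `ℱ(w) = ∫_Q f * conj w` on `L²(Q)`. -/
def formF (T : ℝ) (Ω : Set (EuclideanSpace ℝ (Fin d))) (f w : L2 T Ω) : ℂ :=
  ∫ p in cylinder T Ω, f p * conj (w p)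

/-- `u ∈ 𝒱` solves the space-time variational problem with datum `f`:
`𝒜(u, w) = ℱ(w)` for all `w ∈ L²(Q)`. -/
def IsVariationalSolution (ν T : ℝ) (Ω : Set (EuclideanSpace ℝ (Fin d))) (f : L2 T Ω)
    (u : V ν T Ω) : Prop :=
  ∀ w : L2 T Ω, formA ν T Ω u w = formF T Ω f w

/-- Well-posedness of the variational problem: each `f ∈ L²(Q)` has exactly one solution, and
the solution depends continuously on `f`. -/
def WellPosed (ν T : ℝ) (Ω : Set (EuclideanSpace ℝ (Fin d))) : Prop :=
  (∀ f : L2 T Ω, ∃! u : V ν T Ω, IsVariationalSolution ν T Ω f u) ∧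
    ∃ C : ℝ, ∀ (f : L2 T Ω) (u : V ν T Ω), IsVariationalSolution ν T Ω f u → ‖u‖ ≤ C * ‖f‖

end SchrodingerST

end

/-!
The proof rests on the a priori estimate `‖φ‖ ≤ 2 T ‖S φ‖` in `L²(Q)`, both for `φ ∈ D₀` and for
`φ ∈ D_T`. To obtain it, `S φ = i ∂ₜ φ - ν Δ φ` is tested with `(α - t) φ`, where `α = T` for `D₀`
and `α = 0` for `D_T`, so that `(α - t) φ` vanishes at both ends of the time interval. In the
imaginary part the Laplacian disappears, because `∫_Ω Δφ conj φ` is real at each time, and an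
integration by parts in time turns the rest into `½ ∫_Q |φ|²` (`setIntegral_norm_sq_eq`).

No regularity of `∂Ω` is available, hence no divergence theorem on `Ω`. For the Laplacian term,
`conj φ` is truncated to a `C¹` function that vanishes near `∂Ω`, for which integration by parts is
elementary. As the truncation is removed the boundary plays no role, and the remaining integral of
`|∂ⱼ φ|²` over `{φ ≠ 0}` is real (`setIntegral_im_fderiv_fderiv_mul_conj`).

By density the estimate extends to `𝒱` (`norm_incl_le_S`). It extends to `𝒱*` as well
(`norm_incl_le_adjoint`), because the domain of `S` contains `C₀^∞(Q)`, so that `S` is densely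
defined and `S*` acts as the distribution `S` (`isWeakS_adjoint`). The estimate on `𝒱` makes `S`
injective and, since its graph is closed, gives it a closed range. The orthogonal complement of the
range is the kernel of `S*`, which is trivial by the estimate on `𝒱*`, so `S` is surjective.
Testing the variational equation with all of `L²(Q)` reduces it to `S u = f`.
-/

namespace SchrodingerST

/-! ### Green's formula on an arbitrary bounded open set -/

section Green

open Filter Topology

/-- A `C¹` truncation `G` of complex conjugation that vanishes near `0`. The rescaled maps
`z ↦ G (r z) / r` converge to `conj` as `r → ∞`, and their derivatives are bounded uniformly
in `r`. -/
theorem exists_conj_truncation : ∃ G : ℂ → ℂ, ContDiff ℝ 1 G ∧ (∀ z, ‖z‖ ≤ 1 → G z = 0) ∧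
    (∀ z, ‖G z‖ ≤ ‖z‖) ∧ (∀ z, 2 < ‖z‖ → G z = conj z) ∧
    ∃ M : ℝ, ∀ z, ‖fderiv ℝ G z‖ ≤ M := by
  let b : ContDiffBump (0 : ℂ) := ⟨1, 2, by norm_num, by norm_num⟩
  have hconj : ContDiff ℝ 1 fun z : ℂ => conj z := Complex.conjCLE.contDiff
  have hb : ContDiff ℝ 1 fun z : ℂ => b z • conj z := b.contDiff.smul hconj
  have hcs : HasCompactSupport fun z : ℂ => b z • conj z := b.hasCompactSupport.smul_right
  obtain ⟨M, hM⟩ := (hcs.fderiv (𝕜 := ℝ)).exists_bound_of_continuous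
    (hb.continuous_fderiv (by norm_num))
  refine ⟨fun z => conj z - b z • conj z, hconj.sub hb, fun z hz => ?_, fun z => ?_,
    fun z hz => ?_, ‖(Complex.conjCLE : ℂ →L[ℝ] ℂ)‖ + M, fun z => ?_⟩
  · have : b z = 1 := b.one_of_mem_closedBall (by simpa [b] using hz)
    simp [this]
  · have e : conj z - b z • conj z = (1 - b z) • conj z := by rw [sub_smul, one_smul]
    have h0 := b.nonneg (x := z)
    have h1 := b.le_one (x := z)
    beta_reduce
    rw [e, norm_smul, Real.norm_of_nonneg (by linarith), RCLike.norm_conj]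
    exact mul_le_of_le_one_left (norm_nonneg _) (by linarith)
  · have : b z = 0 := b.zero_of_le_dist (by simpa [b] using hz.le)
    simp [this]
  · have e : fderiv ℝ (fun z : ℂ => conj z - b z • conj z) z =
        (Complex.conjCLE : ℂ →L[ℝ] ℂ) - fderiv ℝ (fun z : ℂ => b z • conj z) z := by
      rw [fderiv_fun_sub (hconj.differentiable (by norm_num) z)
        (hb.differentiable (by norm_num) z)]
      congr 1
      exact Complex.conjCLE.fderiv
    rw [e]
    exact (norm_sub_le _ _).trans (by gcongr; exact hM z)

variable {E : Type*} [NormedAddCommGroup E] [NormedSpace ℝ E] [FiniteDimensional ℝ E]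
  [MeasurableSpace E] [BorelSpace E] {μ : Measure E}

theorem integrableOn_of_continuous_of_isBounded [IsFiniteMeasureOnCompacts μ] {U : Set E}
    (hb : Bornology.IsBounded U) {F : Type*} [NormedAddCommGroup F] {f : E → F}
    (hf : Continuous f) : IntegrableOn f U μ :=
  (hf.continuousOn.integrableOn_compact hb.isCompact_closure).mono_set subset_closure

variable [μ.IsAddHaarMeasure]

/-- The integral of a derivative over a bounded open set `U` vanishes if the function vanishes
near `∂U`: its extension by zero is `C¹` with compact support. -/
theorem setIntegral_fderiv_eq_zero {U : Set E} (hU : IsOpen U) (hb : Bornology.IsBounded U)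
    {F : E → ℂ} (hF : ContDiff ℝ 1 F) (h0 : ∀ x ∈ frontier U, F =ᶠ[𝓝 x] 0) (e : E) :
    ∫ x in U, fderiv ℝ F x e ∂μ = 0 := by
  have hc : Continuous fun x => fderiv ℝ F x e :=
    (hF.continuous_fderiv (by norm_num)).clm_apply continuous_const
  have hd : ∀ x, HasLineDerivAt ℝ (U.indicator F)
      (U.indicator (fun x => fderiv ℝ F x e) x) x e := by
    intro x
    by_cases hx : x ∈ U
    · rw [indicator_of_mem hx]
      refine HasFDerivAt.hasLineDerivAt ?_ e
      refine (hF.differentiable (by norm_num) x).hasFDerivAt.congr_of_eventuallyEq ?_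
      filter_upwards [hU.mem_nhds hx] with y hy using indicator_of_mem hy F
    · rw [indicator_of_notMem hx]
      have hz : U.indicator F =ᶠ[𝓝 x] fun _ => 0 := by
        by_cases hx' : x ∈ closure U
        · have hfr : x ∈ frontier U := ⟨hx', by rwa [hU.interior_eq]⟩
          filter_upwards [h0 x hfr] with y hy
          by_cases hy' : y ∈ U
          · rw [indicator_of_mem hy', hy, Pi.zero_apply]
          · rw [indicator_of_notMem hy']
        · filter_upwards [isClosed_closure.isOpen_compl.mem_nhds hx'] with y hy
          exact indicator_of_notMem (fun h => hy (subset_closure h)) F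
      have := (hasFDerivAt_const (𝕜 := ℝ) (0 : ℂ) x).congr_of_eventuallyEq hz
      simpa using this.hasLineDerivAt e
  have hi : ∀ {g : E → ℂ}, Continuous g → Integrable (U.indicator g) μ := fun hg =>
    (integrable_indicator_iff hU.measurableSet).2 (integrableOn_of_continuous_of_isBounded hb hg)
  have key := integral_bilinear_hasLineDerivAt_right_eq_neg_left_of_integrable (μ := μ)
    (B := ContinuousLinearMap.mul ℝ ℂ) (f := fun _ : E => (1 : ℂ)) (f' := fun _ => 0)
    (g := U.indicator F) (g' := U.indicator fun x => fderiv ℝ F x e) (v := e)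
    (by simp) (by simpa using hi hc) (by simpa using hi hF.continuous)
    (fun x _ => by
      simpa using (hasFDerivAt_const (𝕜 := ℝ) (1 : ℂ) x).hasLineDerivAt e)
    (fun x _ => hd x)
  simpa [integral_indicator hU.measurableSet] using key

/-- Integration by parts on a bounded open set `U`, whose boundary is arbitrary, for a function
`f` that vanishes on `∂U`. One first replaces `conj f` by a truncation that vanishes near `∂U`;
in the limit the set `{f = 0}` is cut out of the second term. -/
theorem setIntegral_fderiv_mul_conj {U : Set E} (hU : IsOpen U) (hb : Bornology.IsBounded U)
    {a f : E → ℂ} (ha : ContDiff ℝ 1 a) (hf : ContDiff ℝ 1 f) (h0 : ∀ x ∈ frontier U, f x = 0)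
    (e : E) :
    IntegrableOn (fun x => fderiv ℝ a x e * conj (f x) +
      {y | f y ≠ 0}.indicator (fun y => a y * conj (fderiv ℝ f y e)) x) U μ ∧
    ∫ x in U, (fderiv ℝ a x e * conj (f x) +
      {y | f y ≠ 0}.indicator (fun y => a y * conj (fderiv ℝ f y e)) x) ∂μ = 0 := by
  obtain ⟨G, hG, hG0, hGle, hG1, M, hM⟩ := exists_conj_truncation
  have hca : Continuous fun x => fderiv ℝ a x e :=
    (ha.continuous_fderiv (by norm_num)).clm_apply continuous_const
  have hcf : Continuous fun x => fderiv ℝ f x e :=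
    (hf.continuous_fderiv (by norm_num)).clm_apply continuous_const
  have hG00 : G 0 = 0 := hG0 0 (by simp)
  -- `G` vanishes near `0` and equals `conj` far from `0`.
  have hdG0 : fderiv ℝ G 0 = 0 := by
    have : G =ᶠ[𝓝 0] fun _ => 0 := by
      filter_upwards [Metric.ball_mem_nhds (0 : ℂ) one_pos] with z hz
      exact hG0 z (mem_ball_zero_iff.1 hz).le
    rw [this.fderiv_eq, fderiv_const_apply]
  have hdG1 : ∀ z, 2 < ‖z‖ → fderiv ℝ G z = (Complex.conjCLE : ℂ →L[ℝ] ℂ) := by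
    intro z hz
    have : G =ᶠ[𝓝 z] Complex.conjCLE := by
      filter_upwards [(isOpen_lt continuous_const continuous_norm).mem_nhds hz] with w hw
      exact hG1 w hw
    rw [this.fderiv_eq]
    exact Complex.conjCLE.fderiv
  let c : ℕ → ℝ := fun n => n + 1
  have hc : ∀ n, 0 < c n := fun n => by positivity
  let g : ℕ → E → ℂ := fun n x => (c n)⁻¹ • G (c n • f x)
  let g' : ℕ → E → ℂ := fun n x => fderiv ℝ G (c n • f x) (fderiv ℝ f x e)
  have hg : ∀ n, ContDiff ℝ 1 (g n) := fun n =>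
    ContDiff.const_smul _ (hG.comp (ContDiff.const_smul (c n) hf))
  have hgd : ∀ n x, fderiv ℝ (fun y => a y * g n y) x e =
      fderiv ℝ a x e * g n x + a x * g' n x := by
    intro n x
    have h1 : HasFDerivAt (g n) ((c n)⁻¹ • (fderiv ℝ G (c n • f x)).comp
        (c n • fderiv ℝ f x)) x :=
      ((hG.differentiable (by norm_num) _).hasFDerivAt.comp x
        ((hf.differentiable (by norm_num) x).hasFDerivAt.const_smul (c n))).const_smul (c n)⁻¹
    have h2 := (ha.differentiable (by norm_num) x).hasFDerivAt.mul h1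
    have h3 := (hc n).ne'
    rw [show (fun y => a y * g n y) = a * g n from rfl, h2.fderiv]
    simp only [add_apply, smul_apply,
      ContinuousLinearMap.comp_apply, map_smul, smul_smul, inv_mul_cancel₀ h3, one_smul,
      smul_eq_mul, g']
    ring
  have hzero : ∀ n, ∫ x in U, (fderiv ℝ a x e * g n x + a x * g' n x) ∂μ = 0 := by
    intro n
    simp_rw [← hgd n]
    refine setIntegral_fderiv_eq_zero hU hb (ha.mul (hg n)) (fun x hx => ?_) e
    have hcont : Continuous fun y => ‖c n • f y‖ := (hf.continuous.const_smul (c n)).norm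
    have hlt : ‖c n • f x‖ < 1 := by simp [h0 x hx]
    filter_upwards [(isOpen_lt hcont continuous_const).mem_nhds hlt] with y hy
    simp only [g, hG0 _ (le_of_lt hy), smul_zero, mul_zero, Pi.zero_apply]
  have hgle : ∀ n x, ‖g n x‖ ≤ ‖f x‖ := by
    intro n x
    have h := hGle (c n • f x)
    rw [norm_smul, Real.norm_of_nonneg (hc n).le] at h
    rw [norm_smul, norm_inv, Real.norm_of_nonneg (hc n).le]
    exact inv_mul_le_of_le_mul₀ (hc n).le (norm_nonneg _) h
  have hg'le : ∀ n x, ‖g' n x‖ ≤ M * ‖fderiv ℝ f x e‖ := fun n x =>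
    ContinuousLinearMap.le_of_opNorm_le _ (hM _) _
  have hg'c : ∀ n, Continuous (g' n) := fun n =>
    ((hG.continuous_fderiv (by norm_num)).comp (hf.continuous.const_smul (c n))).clm_apply hcf
  have hF : ∀ n, Continuous fun x => fderiv ℝ a x e * g n x + a x * g' n x := fun n =>
    (hca.mul (hg n).continuous).add (ha.continuous.mul (hg'c n))
  -- Pointwise, the truncations are eventually constant in `n`.
  have hlim : ∀ x, ∀ᶠ n in atTop, fderiv ℝ a x e * g n x + a x * g' n x =
      fderiv ℝ a x e * conj (f x) +
        {y | f y ≠ 0}.indicator (fun y => a y * conj (fderiv ℝ f y e)) x := by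
    intro x
    by_cases hx : f x = 0
    · refine Eventually.of_forall fun n => ?_
      simp [g, g', hx, hG00, hdG0]
    · have ht : Tendsto (fun n : ℕ => c n * ‖f x‖) atTop atTop :=
        (tendsto_atTop_add_const_right _ _ tendsto_natCast_atTop_atTop).atTop_mul_const
          (norm_pos_iff.2 hx)
      filter_upwards [ht.eventually_gt_atTop 2] with n hn
      have hn' : 2 < ‖c n • f x‖ := by rwa [norm_smul, Real.norm_of_nonneg (hc n).le]
      have h3 : ((c n : ℝ) : ℂ) ≠ 0 := by exact_mod_cast (hc n).ne'
      rw [indicator_of_mem (show x ∈ {y | f y ≠ 0} from hx)]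
      simp only [g, g', hG1 _ hn', hdG1 _ hn']
      simp [h3]
  have hbound : IntegrableOn (fun x => ‖fderiv ℝ a x e‖ * ‖f x‖ +
      ‖a x‖ * (M * ‖fderiv ℝ f x e‖)) U μ :=
    integrableOn_of_continuous_of_isBounded hb ((hca.norm.mul hf.continuous.norm).add
      (ha.continuous.norm.mul (continuous_const.mul hcf.norm)))
  have hle : ∀ n x, ‖fderiv ℝ a x e * g n x + a x * g' n x‖ ≤
      ‖fderiv ℝ a x e‖ * ‖f x‖ + ‖a x‖ * (M * ‖fderiv ℝ f x e‖) := by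
    intro n x
    refine (norm_add_le _ _).trans ?_
    rw [norm_mul, norm_mul]
    gcongr
    exacts [hgle n x, hg'le n x]
  have htend : ∀ x, Tendsto (fun n => fderiv ℝ a x e * g n x + a x * g' n x) atTop
      (𝓝 (fderiv ℝ a x e * conj (f x) +
        {y | f y ≠ 0}.indicator (fun y => a y * conj (fderiv ℝ f y e)) x)) := fun x =>
    tendsto_const_nhds.congr' ((hlim x).mono fun n hn => hn.symm)
  have hT := tendsto_integral_of_dominated_convergence _
    (fun n => (hF n).aestronglyMeasurable) hbound
    (fun n => Eventually.of_forall (hle n)) (Eventually.of_forall htend)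
  refine ⟨?_, ?_⟩
  · refine Integrable.mono' hbound
      (aestronglyMeasurable_of_tendsto_ae atTop (fun n => (hF n).aestronglyMeasurable)
        (Eventually.of_forall htend)) (Eventually.of_forall fun x => ?_)
    obtain ⟨n, hn⟩ := (hlim x).exists
    rw [← hn]
    exact hle n x
  · simp_rw [hzero] at hT
    exact tendsto_nhds_unique hT tendsto_const_nhds

/-- The second derivative in a direction is symmetric on functions that vanish on `∂U`, in the
form that `(∂ₑ∂ₑ f, f)` is real. -/
theorem setIntegral_im_fderiv_fderiv_mul_conj {U : Set E} (hU : IsOpen U)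
    (hb : Bornology.IsBounded U) {f : E → ℂ} (hf : ContDiff ℝ 2 f)
    (h0 : ∀ x ∈ frontier U, f x = 0) (e : E) :
    ∫ x in U, (fderiv ℝ (fun y => fderiv ℝ f y e) x e * conj (f x)).im ∂μ = 0 := by
  have ha : ContDiff ℝ 1 fun y => fderiv ℝ f y e :=
    (hf.fderiv_right (m := 1) (by norm_num)).clm_apply contDiff_const
  obtain ⟨hi, hz⟩ := setIntegral_fderiv_mul_conj (μ := μ) hU hb ha
    (hf.of_le (by norm_num)) h0 e
  have him := integral_im hi
  rw [hz, map_zero] at him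
  rw [← him]
  refine integral_congr_ae (Eventually.of_forall fun x => ?_)
  by_cases hx : f x = 0
  · simp [hx]
  · beta_reduce
    rw [indicator_of_mem (show x ∈ {y | f y ≠ 0} from hx), Complex.mul_conj]
    simp

end Green

/-! ### Test functions and weak derivatives in `L²(Q)` -/

section Weak

variable {d : ℕ} {T ν : ℝ} {Ω : Set (EuclideanSpace ℝ (Fin d))} {φ χ ψ : SpaceTime d → ℂ}

theorem conj_mem (h : φ ∈ SmoothCompact d) : (fun p => conj (φ p)) ∈ SmoothCompact d :=
  ⟨Complex.conjCLE.contDiff.comp h.1, h.2.comp_left (g := fun z : ℂ => conj z) (map_zero _)⟩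

theorem fderiv_conj_apply (φ : SpaceTime d → ℂ) (p e : SpaceTime d) :
    fderiv ℝ (fun q => conj (φ q)) p e = conj (fderiv ℝ φ p e) := by
  have := Complex.conjCLE.comp_fderiv (f := φ) (x := p)
  exact congrArg (fun L : SpaceTime d →L[ℝ] ℂ => L e) this

theorem spaceLaplacian_conj (φ : SpaceTime d → ℂ) (p : SpaceTime d) :
    spaceLaplacian (fun q => conj (φ q)) p = conj (spaceLaplacian φ p) := by
  have h : ∀ (j : Fin d) (η : SpaceTime d → ℂ),
      spaceDeriv j (fun q => conj (η q)) = fun q => conj (spaceDeriv j η q) :=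
    fun j η => funext fun q => fderiv_conj_apply η q _
  simp [spaceLaplacian, h, map_sum]

theorem smoothSTranspose_conj (ν : ℝ) (φ : SpaceTime d → ℂ) (p : SpaceTime d) :
    smoothSTranspose ν (fun q => conj (φ q)) p = conj (smoothS ν φ p) := by
  simp [smoothSTranspose, smoothS, spaceLaplacian_conj, timeDeriv, fderiv_conj_apply]

theorem smoothS_conj (ν : ℝ) (φ : SpaceTime d → ℂ) (p : SpaceTime d) :
    smoothS ν (fun q => conj (φ q)) p = conj (smoothSTranspose ν φ p) := by
  simp [smoothSTranspose, smoothS, spaceLaplacian_conj, timeDeriv, fderiv_conj_apply]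

theorem tsupport_spaceLaplacian_subset (φ : SpaceTime d → ℂ) :
    tsupport (spaceLaplacian φ) ⊆ tsupport φ := by
  refine closure_minimal (fun p hp => ?_) (isClosed_tsupport φ)
  by_contra h
  refine hp (Finset.sum_eq_zero fun j _ => ?_)
  exact image_eq_zero_of_notMem_tsupport fun h' =>
    h (tsupport_fderiv_apply_subset ℝ _ (tsupport_fderiv_apply_subset ℝ _ h'))

theorem smoothSTranspose_eq_zero {p : SpaceTime d} (h : p ∉ tsupport φ) :
    smoothSTranspose ν φ p = 0 := by
  have h1 : timeDeriv φ p = 0 :=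
    image_eq_zero_of_notMem_tsupport fun h' => h (tsupport_fderiv_apply_subset ℝ _ h')
  have h2 : spaceLaplacian φ p = 0 :=
    image_eq_zero_of_notMem_tsupport fun h' => h (tsupport_spaceLaplacian_subset φ h')
  simp [smoothSTranspose, h1, h2]

theorem integrable_mul_of_mem (hφ : φ ∈ SmoothCompact d) (hχ : χ ∈ SmoothCompact d) :
    Integrable fun p => φ p * χ p :=
  (hφ.1.continuous.mul hχ.1.continuous).integrable_of_hasCompactSupport hφ.2.mul_right

theorem fderiv_apply_mem (h : φ ∈ SmoothCompact d) (e : SpaceTime d) :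
    (fun p => fderiv ℝ φ p e) ∈ SmoothCompact d :=
  ⟨(h.1.fderiv_right (m := ∞) (by simp)).clm_apply contDiff_const, h.2.fderiv_apply (𝕜 := ℝ) _⟩

theorem integral_mul_fderiv (hφ : φ ∈ SmoothCompact d) (hχ : χ ∈ SmoothCompact d)
    (e : SpaceTime d) : ∫ p, φ p * fderiv ℝ χ p e = -∫ p, fderiv ℝ φ p e * χ p := by
  have : (volume : Measure (SpaceTime d)).IsAddHaarMeasure :=
    Measure.prod.instIsAddHaarMeasure volume volume
  exact integral_mul_fderiv_eq_neg_fderiv_mul_of_integrable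
    (integrable_mul_of_mem (fderiv_apply_mem hφ e) hχ)
    (integrable_mul_of_mem hφ (fderiv_apply_mem hχ e)) (integrable_mul_of_mem hφ hχ)
    (fun p _ => hφ.1.differentiable (by simp) p) (fun p _ => hχ.1.differentiable (by simp) p)

theorem integral_mul_spaceLaplacian (hφ : φ ∈ SmoothCompact d) (hχ : χ ∈ SmoothCompact d) :
    ∫ p, φ p * spaceLaplacian χ p = ∫ p, spaceLaplacian φ p * χ p := by
  have hm : ∀ {η : SpaceTime d → ℂ}, η ∈ SmoothCompact d → ∀ j, spaceDeriv j η ∈ SmoothCompact d :=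
    fun hη j => fderiv_apply_mem hη _
  simp only [spaceLaplacian, Finset.mul_sum, Finset.sum_mul]
  rw [integral_finsetSum _ fun j _ => integrable_mul_of_mem hφ (hm (hm hχ j) j),
    integral_finsetSum _ fun j _ => integrable_mul_of_mem (hm (hm hφ j) j) hχ]
  refine Finset.sum_congr rfl fun j _ => ?_
  refine (integral_mul_fderiv hφ (hm hχ j) _).trans ?_
  have := integral_mul_fderiv (hm hφ j) hχ (0, EuclideanSpace.single j 1)
  rw [← neg_eq_iff_eq_neg] at this
  exact this

theorem integral_mul_smoothSTranspose (hφ : φ ∈ SmoothCompact d) (hχ : χ ∈ SmoothCompact d) :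
    ∫ p, φ p * smoothSTranspose ν χ p = ∫ p, smoothS ν φ p * χ p := by
  have ht : ∫ p, φ p * timeDeriv χ p = -∫ p, timeDeriv φ p * χ p := integral_mul_fderiv hφ hχ _
  have e1 : ∀ p, φ p * smoothSTranspose ν χ p =
      -Complex.I * (φ p * timeDeriv χ p) - (ν : ℂ) * (φ p * spaceLaplacian χ p) := fun p => by
    simp only [smoothSTranspose]; ring
  have e2 : ∀ p, smoothS ν φ p * χ p =
      Complex.I * (timeDeriv φ p * χ p) - (ν : ℂ) * (spaceLaplacian φ p * χ p) := fun p => by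
    simp only [smoothS]; ring
  have ht1 : timeDeriv φ ∈ SmoothCompact d := fderiv_apply_mem hφ _
  have ht2 : timeDeriv χ ∈ SmoothCompact d := fderiv_apply_mem hχ _
  simp_rw [e1, e2]
  rw [integral_sub ((integrable_mul_of_mem hφ ht2).const_mul _)
      ((integrable_mul_of_mem hφ (spaceLaplacian_mem hχ)).const_mul _),
    integral_sub ((integrable_mul_of_mem ht1 hχ).const_mul _)
      ((integrable_mul_of_mem (spaceLaplacian_mem hφ) hχ).const_mul _)]
  simp only [integral_const_mul]
  rw [ht, integral_mul_spaceLaplacian hφ hχ]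
  ring

theorem setIntegral_mul_smoothSTranspose (hφ : φ ∈ SmoothCompact d) (hχ : χ ∈ SmoothCompact d)
    (hs : tsupport χ ⊆ cylinder T Ω) :
    ∫ p in cylinder T Ω, φ p * smoothSTranspose ν χ p =
      ∫ p in cylinder T Ω, smoothS ν φ p * χ p := by
  rw [setIntegral_eq_integral_of_forall_compl_eq_zero,
    setIntegral_eq_integral_of_forall_compl_eq_zero, integral_mul_smoothSTranspose hφ hχ]
  · intro p hp
    rw [image_eq_zero_of_notMem_tsupport fun h => hp (hs h), mul_zero]
  · intro p hp
    rw [smoothSTranspose_eq_zero fun h => hp (hs h), mul_zero]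

theorem tsupport_conj_subset (φ : SpaceTime d → ℂ) :
    tsupport (fun p => conj (φ p)) ⊆ tsupport φ :=
  tsupport_comp_subset (g := fun z : ℂ => conj z) (map_zero _) φ

theorem setIntegral_mul_conj_smoothS (hψ : ψ ∈ SmoothCompact d) (hχ : χ ∈ SmoothCompact d)
    (hs : tsupport χ ⊆ cylinder T Ω) :
    ∫ p in cylinder T Ω, ψ p * conj (smoothS ν χ p) =
      ∫ p in cylinder T Ω, smoothS ν ψ p * conj (χ p) := by
  simp_rw [← smoothSTranspose_conj]
  exact setIntegral_mul_smoothSTranspose hψ (conj_mem hχ) ((tsupport_conj_subset χ).trans hs)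

/-- The element of `L²(Q)` given by a function in `C₀^∞(ℝ^{d+1})`. -/
noncomputable def restrictL2 (T : ℝ) (Ω : Set (EuclideanSpace ℝ (Fin d)))
    (h : φ ∈ SmoothCompact d) : L2 T Ω :=
  (memLp_of_mem h _).toLp φ

theorem coeFn_restrictL2 (h : φ ∈ SmoothCompact d) :
    restrictL2 T Ω h =ᵐ[volume.restrict (cylinder T Ω)] φ :=
  MemLp.coeFn_toLp _

theorem inner_eq_integral (v w : L2 T Ω) :
    inner ℂ v w = ∫ p in cylinder T Ω, w p * conj (v p) := rfl

theorem integral_mul_conj_eq_inner (h : φ ∈ SmoothCompact d) (v : L2 T Ω) :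
    ∫ p in cylinder T Ω, φ p * conj (v p) = inner ℂ v (restrictL2 T Ω h) := by
  rw [inner_eq_integral]
  refine integral_congr_ae ?_
  filter_upwards [coeFn_restrictL2 (T := T) (Ω := Ω) h] with p hp
  rw [hp]

theorem integral_mul_eq_inner (h : φ ∈ SmoothCompact d) (v : L2 T Ω) :
    ∫ p in cylinder T Ω, v p * φ p = inner ℂ (restrictL2 T Ω (conj_mem h)) v := by
  rw [inner_eq_integral]
  refine integral_congr_ae ?_
  filter_upwards [coeFn_restrictL2 (T := T) (Ω := Ω) (conj_mem h)] with p hp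
  rw [hp, Complex.conj_conj]

/-- The test functions `C₀^∞(Q)` are total in `L²(Q)`. -/
theorem eq_zero_of_integral_mul_eq_zero (hΩ : IsOpen Ω) {z : L2 T Ω}
    (h : ∀ χ ∈ SmoothCompact d, tsupport χ ⊆ cylinder T Ω →
      ∫ p in cylinder T Ω, z p * χ p = 0) : z = 0 := by
  have hQ : IsOpen (cylinder T Ω) := isOpen_Ioo.prod hΩ
  have hl : LocallyIntegrableOn z (cylinder T Ω) (volume.restrict (cylinder T Ω)) :=
    ((Lp.memLp z).locallyIntegrable (by norm_num)).locallyIntegrableOn _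
  have hz := hQ.ae_eq_zero_of_integral_contDiff_smul_eq_zero hl (by
    intro f hf hc hs
    have hm : (fun p => ((f p : ℝ) : ℂ)) ∈ SmoothCompact d :=
      ⟨Complex.ofRealCLM.contDiff.comp hf, hc.comp_left (g := Complex.ofReal) rfl⟩
    rw [← h _ hm ((tsupport_comp_subset (g := Complex.ofReal) rfl f).trans hs)]
    refine integral_congr_ae (Filter.Eventually.of_forall fun p => ?_)
    simp [mul_comm])
  refine Lp.eq_zero_iff_ae_eq_zero.2 ?_
  filter_upwards [hz, ae_restrict_mem hQ.measurableSet] with p hp hp'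
  exact hp hp'

theorem IsWeakS.unique (hΩ : IsOpen Ω) {v g k : L2 T Ω} (h : IsWeakS ν T Ω v g)
    (h' : IsWeakS ν T Ω v k) : g = k := by
  refine sub_eq_zero.1 (eq_zero_of_integral_mul_eq_zero hΩ fun χ hχ hs => ?_)
  have e := (h χ hχ hs).symm.trans (h' χ hχ hs)
  rw [integral_mul_eq_inner hχ, integral_mul_eq_inner hχ] at e
  rw [integral_mul_eq_inner hχ, inner_sub_right, e, sub_self]

theorem isWeakS_of_ae_eq (hφ : φ ∈ SmoothCompact d) {v : L2 T Ω}
    (hv : v =ᵐ[volume.restrict (cylinder T Ω)] φ) :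
    IsWeakS ν T Ω v (restrictL2 T Ω (smoothS_mem ν hφ)) := by
  intro χ hχ hs
  have e1 : ∫ p in cylinder T Ω, v p * smoothSTranspose ν χ p =
      ∫ p in cylinder T Ω, φ p * smoothSTranspose ν χ p :=
    integral_congr_ae (hv.mono fun p hp => by simp only [hp])
  have e2 : ∫ p in cylinder T Ω, restrictL2 T Ω (smoothS_mem ν hφ) p * χ p =
      ∫ p in cylinder T Ω, smoothS ν φ p * χ p :=
    integral_congr_ae 
      ((coeFn_restrictL2 (smoothS_mem ν hφ)).mono fun p hp => by simp only [hp])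
  rw [e1, e2, setIntegral_mul_smoothSTranspose hφ hχ hs]

/-- Weak and classical values of `S` agree on smooth functions. -/
theorem IsWeakS.ae_eq_smoothS (hΩ : IsOpen Ω) (hφ : φ ∈ SmoothCompact d) {v g : L2 T Ω}
    (h : IsWeakS ν T Ω v g) (hv : v =ᵐ[volume.restrict (cylinder T Ω)] φ) :
    g =ᵐ[volume.restrict (cylinder T Ω)] smoothS ν φ := by
  rw [h.unique hΩ (isWeakS_of_ae_eq hφ hv)]
  exact coeFn_restrictL2 _

end Weak

/-! ### The weighted energy estimate -/

section Energy

variable {d : ℕ} {T ν : ℝ} {Ω : Set (EuclideanSpace ℝ (Fin d))} {φ : SpaceTime d → ℂ}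

theorem isBounded_cylinder (hb : Bornology.IsBounded Ω) :
    Bornology.IsBounded (cylinder T Ω) :=
  (Metric.isBounded_Ioo 0 T).prod hb

theorem integrableOn_cylinder (hb : Bornology.IsBounded Ω) {f : SpaceTime d → ℝ}
    (hf : Continuous f) : IntegrableOn f (cylinder T Ω) :=
  (hf.continuousOn.integrableOn_compact (isBounded_cylinder hb).isCompact_closure).mono_set
    subset_closure

theorem setIntegral_cylinder_time_space (hb : Bornology.IsBounded Ω) {f : SpaceTime d → ℝ}
    (hf : Continuous f) :
    ∫ p in cylinder T Ω, f p = ∫ t in Ioo 0 T, ∫ x in Ω, f (t, x) :=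
  setIntegral_prod f (integrableOn_cylinder hb hf)

theorem setIntegral_cylinder_space_time (hb : Bornology.IsBounded Ω) {f : SpaceTime d → ℝ}
    (hf : Continuous f) :
    ∫ p in cylinder T Ω, f p = ∫ x in Ω, ∫ t in Ioo 0 T, f (t, x) := by
  have h := integrableOn_cylinder (T := T) hb hf
  rw [IntegrableOn, Measure.volume_eq_prod, cylinder, ← Measure.prod_restrict] at h
  rw [Measure.volume_eq_prod, cylinder, ← Measure.prod_restrict]
  exact integral_prod_symm f h

theorem fderiv_slice (hφ : Differentiable ℝ φ) (t : ℝ) (x e : EuclideanSpace ℝ (Fin d)) :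
    fderiv ℝ (fun y => φ (t, y)) x e = fderiv ℝ φ (t, x) (0, e) := by
  have := (hφ (t, x)).hasFDerivAt.comp x (hasFDerivAt_prodMk_right (𝕜 := ℝ) t x)
  rw [show (fun y => φ (t, y)) = φ ∘ fun y => (t, y) from rfl, this.fderiv]
  simp

theorem hasDerivAt_slice (hφ : Differentiable ℝ φ) (t : ℝ) (x : EuclideanSpace ℝ (Fin d)) :
    HasDerivAt (fun s => φ (s, x)) (timeDeriv φ (t, x)) t := by
  have := ((hφ (t, x)).hasFDerivAt.comp t (hasFDerivAt_prodMk_left (𝕜 := ℝ) t x)).hasDerivAt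
  simpa [timeDeriv, Function.comp_def] using this

/-- `(Δ φ(t), φ(t))` is real at each time at which `φ` vanishes on `∂Ω`. -/
theorem setIntegral_im_spaceLaplacian_mul_conj (hΩ : IsOpen Ω) (hb : Bornology.IsBounded Ω)
    (hφ : φ ∈ SmoothCompact d) {t : ℝ} (h0 : ∀ x ∈ frontier Ω, φ (t, x) = 0) :
    ∫ x in Ω, (spaceLaplacian φ (t, x) * conj (φ (t, x))).im = 0 := by
  have hsl : ContDiff ℝ ∞ fun y => φ (t, y) := hφ.1.comp (contDiff_prodMk_right t)
  have hc : ∀ j, Continuous fun x =>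
      (spaceDeriv j (spaceDeriv j φ) (t, x) * conj (φ (t, x))).im := fun j =>
    Complex.continuous_im.comp (((contDiff_spaceDeriv (contDiff_spaceDeriv hφ.1 j) j).continuous.comp
      (Continuous.prodMk_right t)).mul (Complex.continuous_conj.comp hsl.continuous))
  simp only [spaceLaplacian, Finset.sum_mul, Complex.im_sum]
  rw [integral_finsetSum _ fun j _ => integrableOn_of_continuous_of_isBounded hb (hc j)]
  refine Finset.sum_eq_zero fun j _ => ?_
  have := setIntegral_im_fderiv_fderiv_mul_conj (μ := volume) hΩ hb
    (by exact_mod_cast contDiff_infty.1 hsl 2) h0 (EuclideanSpace.single j 1)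
  simp_rw [fderiv_slice (hφ.1.differentiable (by simp))] at this
  rw [← this]
  refine integral_congr_ae (Filter.Eventually.of_forall fun x => ?_)
  beta_reduce
  rw [fderiv_slice (φ := fun p => fderiv ℝ φ p (0, EuclideanSpace.single j 1))
    ((contDiff_spaceDeriv hφ.1 j).differentiable (by simp))]
  rfl

/-- Integration by parts in time against the weight `α - t`, for a function with
`(α - t) φ(t) = 0` at both ends of the time interval. -/
theorem setIntegral_time_weighted (hT : 0 ≤ T) (hφ : φ ∈ SmoothCompact d) {α : ℝ}
    {x : EuclideanSpace ℝ (Fin d)} (h0 : α * ‖φ (0, x)‖ ^ 2 = 0)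
    (hT' : (α - T) * ‖φ (T, x)‖ ^ 2 = 0) :
    ∫ t in Ioo 0 T, ((α - t) * (2 * (timeDeriv φ (t, x) * conj (φ (t, x))).re) -
      ‖φ (t, x)‖ ^ 2) = 0 := by
  have hd : ∀ t, HasDerivAt (fun s => (α - s) * ‖φ (s, x)‖ ^ 2)
      ((α - t) * (2 * (timeDeriv φ (t, x) * conj (φ (t, x))).re) - ‖φ (t, x)‖ ^ 2) t := by
    intro t
    have h := ((hasDerivAt_const t α).sub (hasDerivAt_id t)).mul
      (hasDerivAt_slice (hφ.1.differentiable (by simp)) t x).norm_sq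
    refine HasDerivAt.congr_deriv h ?_
    simp only [Complex.inner, Pi.sub_apply, id]
    ring
  have hs : Continuous fun t : ℝ => ((t, x) : SpaceTime d) := Continuous.prodMk_left x
  have h1 : Continuous fun t => φ (t, x) := hφ.1.continuous.comp hs
  have h2 : Continuous fun t => timeDeriv φ (t, x) := (contDiff_timeDeriv hφ.1).continuous.comp hs
  have hc : Continuous fun t => (α - t) * (2 * (timeDeriv φ (t, x) * conj (φ (t, x))).re) -
      ‖φ (t, x)‖ ^ 2 :=
    ((continuous_const.sub continuous_id).mul (continuous_const.mul
      (Complex.continuous_re.comp (h2.mul (Complex.continuous_conj.comp h1))))).sub (h1.norm.pow 2)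
  rw [← integral_Ioc_eq_integral_Ioo, ← intervalIntegral.integral_of_le hT,
    intervalIntegral.integral_eq_sub_of_hasDerivAt (fun t _ => hd t) (hc.intervalIntegrable _ _)]
  simp [h0, hT']

theorem weighted_mem (hφ : φ ∈ SmoothCompact d) (α : ℝ) :
    (fun p : SpaceTime d => ((α - p.1 : ℝ) : ℂ) * φ p) ∈ SmoothCompact d :=
  ⟨(Complex.ofRealCLM.contDiff.comp (contDiff_const.sub contDiff_fst)).mul hφ.1, hφ.2.mul_left⟩

/-- The energy identity: `∫_Q |φ|² = 2 Im (S φ, (α - t) φ)`. -/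
theorem setIntegral_norm_sq_eq (hΩ : IsOpen Ω) (hb : Bornology.IsBounded Ω) (hT : 0 ≤ T)
    (hφ : φ ∈ SmoothCompact d) {α : ℝ} (hfr : ∀ p ∈ Ioo 0 T ×ˢ frontier Ω, φ p = 0)
    (h0 : ∀ x ∈ Ω, α * ‖φ (0, x)‖ ^ 2 = 0) (hT' : ∀ x ∈ Ω, (α - T) * ‖φ (T, x)‖ ^ 2 = 0) :
    ∫ p in cylinder T Ω, ‖φ p‖ ^ 2 =
      2 * ∫ p in cylinder T Ω, (smoothS ν φ p * conj (((α - p.1 : ℝ) : ℂ) * φ p)).im := by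
  have hcφ := hφ.1.continuous
  have hc1 : Continuous (timeDeriv φ) := (contDiff_timeDeriv hφ.1).continuous
  have hc2 : Continuous (spaceLaplacian φ) := (spaceLaplacian_mem hφ).1.continuous
  have hα : Continuous fun p : SpaceTime d => α - p.1 := continuous_const.sub continuous_fst
  have hconj := Complex.continuous_conj.comp hcφ
  have hct : Continuous fun p : SpaceTime d =>
      (α - p.1) * (2 * (timeDeriv φ p * conj (φ p)).re) - ‖φ p‖ ^ 2 :=
    (hα.mul (continuous_const.mul (Complex.continuous_re.comp (hc1.mul hconj)))).sub
      (hcφ.norm.pow 2)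
  have hcx : Continuous fun p : SpaceTime d =>
      (α - p.1) * (spaceLaplacian φ p * conj (φ p)).im :=
    hα.mul (Complex.continuous_im.comp (hc2.mul hconj))
  have htime : ∫ p in cylinder T Ω,
      ((α - p.1) * (2 * (timeDeriv φ p * conj (φ p)).re) - ‖φ p‖ ^ 2) = 0 := by
    rw [setIntegral_cylinder_space_time hb hct]
    refine setIntegral_eq_zero_of_forall_eq_zero fun x hx => ?_
    exact setIntegral_time_weighted hT hφ (h0 x hx) (hT' x hx)
  have hspace : ∫ p in cylinder T Ω, (α - p.1) * (spaceLaplacian φ p * conj (φ p)).im = 0 := by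
    rw [setIntegral_cylinder_time_space hb hcx]
    refine setIntegral_eq_zero_of_forall_eq_zero fun t ht => ?_
    change ∫ x in Ω, (α - t) * _ = 0
    rw [integral_const_mul, setIntegral_im_spaceLaplacian_mul_conj hΩ hb hφ
      fun x hx => hfr (t, x) ⟨ht, hx⟩, mul_zero]
  have hpt : ∀ p : SpaceTime d,
      2 * (smoothS ν φ p * conj (((α - p.1 : ℝ) : ℂ) * φ p)).im =
        ((α - p.1) * (2 * (timeDeriv φ p * conj (φ p)).re) - ‖φ p‖ ^ 2) + ‖φ p‖ ^ 2 -
          2 * ν * ((α - p.1) * (spaceLaplacian φ p * conj (φ p)).im) := by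
    intro p
    simp only [smoothS, map_mul, Complex.conj_ofReal, Complex.mul_im, Complex.sub_im,
      Complex.sub_re, Complex.mul_re, Complex.I_re, Complex.I_im, Complex.ofReal_re,
      Complex.ofReal_im, Complex.conj_re, Complex.conj_im]
    ring
  rw [← integral_const_mul]
  simp_rw [hpt]
  rw [integral_sub, integral_add, htime, integral_const_mul, hspace]
  · ring
  · exact integrableOn_cylinder hb hct
  · exact integrableOn_cylinder hb (hcφ.norm.pow 2)
  · exact (integrableOn_cylinder hb hct).add (integrableOn_cylinder hb (hcφ.norm.pow 2))
  · exact (integrableOn_cylinder hb hcx).const_mul _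

/-- The a priori estimate for smooth functions, from the energy identity and the Cauchy-Schwarz
inequality, as the weight `α - t` is at most `T` in absolute value. -/
theorem norm_le_of_ae_eq (hΩ : IsOpen Ω) (hb : Bornology.IsBounded Ω) (hT : 0 ≤ T)
    (hφ : φ ∈ SmoothCompact d) {α : ℝ} (hfr : ∀ p ∈ Ioo 0 T ×ˢ frontier Ω, φ p = 0)
    (h0 : ∀ x ∈ Ω, α * ‖φ (0, x)‖ ^ 2 = 0) (hT' : ∀ x ∈ Ω, (α - T) * ‖φ (T, x)‖ ^ 2 = 0)
    (hα : ∀ t ∈ Ioo 0 T, |α - t| ≤ T) {v s : L2 T Ω}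
    (hv : v =ᵐ[volume.restrict (cylinder T Ω)] φ)
    (hs : s =ᵐ[volume.restrict (cylinder T Ω)] smoothS ν φ) : ‖v‖ ≤ 2 * T * ‖s‖ := by
  have hQ : MeasurableSet (cylinder T Ω) := (isOpen_Ioo.prod hΩ).measurableSet
  let m : L2 T Ω := restrictL2 T Ω (weighted_mem hφ α)
  have hm := coeFn_restrictL2 (T := T) (Ω := Ω) (weighted_mem hφ α)
  have hmle : ‖m‖ ≤ T * ‖v‖ := by
    refine Lp.norm_le_mul_norm_of_ae_le_mul ?_
    filter_upwards [hm, hv, ae_restrict_mem hQ] with p h1 h2 h3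
    rw [h1, h2, norm_mul, Complex.norm_real]
    exact mul_le_mul_of_nonneg_right (hα _ h3.1) (norm_nonneg _)
  have hsq : ‖v‖ ^ 2 = ∫ p in cylinder T Ω, ‖φ p‖ ^ 2 := by
    have h := congrArg Complex.re (inner_eq_integral v v)
    rw [inner_self_eq_norm_sq_to_K] at h
    have e : ∫ p in cylinder T Ω, v p * conj (v p) =
        ((∫ p in cylinder T Ω, ‖φ p‖ ^ 2 : ℝ) : ℂ) := by
      refine Eq.trans (integral_congr_ae ?_) integral_complex_ofReal
      filter_upwards [hv] with p hp
      rw [hp, Complex.mul_conj']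
      simp
    rw [e, Complex.ofReal_re] at h
    rw [← h]
    norm_cast
  have hin : (inner ℂ m s : ℂ).im =
      ∫ p in cylinder T Ω, (smoothS ν φ p * conj (((α - p.1 : ℝ) : ℂ) * φ p)).im := by
    have e : inner ℂ m s =
        ∫ p in cylinder T Ω, smoothS ν φ p * conj (((α - p.1 : ℝ) : ℂ) * φ p) := by
      rw [inner_eq_integral]
      refine integral_congr_ae ?_
      filter_upwards [hm, hs] with p h1 h2
      rw [h2, h1]
    have hi := integrable_mul_of_mem (smoothS_mem ν hφ) (conj_mem (weighted_mem hφ α))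
    rw [e]
    exact (integral_im hi.integrableOn).symm
  have key : ‖v‖ ^ 2 ≤ 2 * (T * ‖v‖ * ‖s‖) := by
    rw [hsq, setIntegral_norm_sq_eq (ν := ν) hΩ hb hT hφ hfr h0 hT', ← hin]
    have h1 : (inner ℂ m s : ℂ).im ≤ ‖m‖ * ‖s‖ :=
      (le_abs_self _).trans ((Complex.abs_im_le_norm _).trans (norm_inner_le_norm m s))
    have h2 := mul_le_mul_of_nonneg_right hmle (norm_nonneg s)
    linarith
  rcases (norm_nonneg v).eq_or_lt with h | h
  · rw [← h]
    positivity
  · refine le_of_mul_le_mul_right ?_ h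
    nlinarith

/-- The weight `T - t` vanishes at `t = T`, where `φ ∈ D₀` need not. -/
theorem norm_le_of_mem_D₀ (hΩ : IsOpen Ω) (hb : Bornology.IsBounded Ω) (hT : 0 ≤ T)
    (hφ : φ ∈ D₀ T Ω) {v s : L2 T Ω} (hv : v =ᵐ[volume.restrict (cylinder T Ω)] φ)
    (hs : s =ᵐ[volume.restrict (cylinder T Ω)] smoothS ν φ) : ‖v‖ ≤ 2 * T * ‖s‖ := by
  refine norm_le_of_ae_eq (α := T) hΩ hb hT hφ.1 (fun p hp => hφ.2 p (Or.inl hp))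
    (fun x hx => ?_) (fun x _ => by simp) (fun t ht => ?_) hv hs
  · rw [hφ.2 (0, x) (Or.inr ⟨rfl, hx⟩)]
    simp
  · rw [abs_le]
    constructor <;> linarith [ht.1, ht.2]

/-- The weight `-t` vanishes at `t = 0`, where `φ ∈ D_T` need not. -/
theorem norm_le_of_mem_D_T (hΩ : IsOpen Ω) (hb : Bornology.IsBounded Ω) (hT : 0 ≤ T)
    (hφ : φ ∈ D_T T Ω) {v s : L2 T Ω} (hv : v =ᵐ[volume.restrict (cylinder T Ω)] φ)
    (hs : s =ᵐ[volume.restrict (cylinder T Ω)] smoothS ν φ) : ‖v‖ ≤ 2 * T * ‖s‖ := by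
  refine norm_le_of_ae_eq (α := 0) hΩ hb hT hφ.1 (fun p hp => hφ.2 p (Or.inl hp))
    (fun x _ => by simp) (fun x hx => ?_) (fun t ht => ?_) hv hs
  · rw [hφ.2 (T, x) (Or.inr ⟨rfl, hx⟩)]
    simp
  · rw [abs_le]
    constructor <;> linarith [ht.1, ht.2]

end Energy

/-! ### The operator `S` and its adjoint -/

section Operator

variable {d : ℕ} {T ν : ℝ} {Ω : Set (EuclideanSpace ℝ (Fin d))} {χ : SpaceTime d → ℂ}

theorem GraphSpace.continuous_toGraph {H : Type*} [NormedAddCommGroup H] [InnerProductSpace ℂ H]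
    (A : H →ₗ.[ℂ] H) : Continuous (GraphSpace.toGraph A) :=
  continuous_induced_dom

theorem GraphSpace.continuous_incl {H : Type*} [NormedAddCommGroup H] [InnerProductSpace ℂ H]
    (A : H →ₗ.[ℂ] H) : Continuous (GraphSpace.incl A) :=
  (WithLp.prod_continuous_ofLp 2 H H).fst.comp (GraphSpace.continuous_toGraph A)

theorem GraphSpace.continuous_op {H : Type*} [NormedAddCommGroup H] [InnerProductSpace ℂ H]
    (A : H →ₗ.[ℂ] H) : Continuous (GraphSpace.op A) :=
  (WithLp.prod_continuous_ofLp 2 H H).snd.comp (GraphSpace.continuous_toGraph A)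

theorem GraphSpace.norm_incl_le_of_dense {H : Type*} [NormedAddCommGroup H]
    [InnerProductSpace ℂ H] {A : H →ₗ.[ℂ] H} {D : Set (GraphSpace A)} (hD : Dense D) {C : ℝ}
    (h : ∀ v ∈ D, ‖GraphSpace.incl A v‖ ≤ C * ‖GraphSpace.op A v‖) (v : GraphSpace A) :
    ‖GraphSpace.incl A v‖ ≤ C * ‖GraphSpace.op A v‖ :=
  closure_minimal h (isClosed_le (GraphSpace.continuous_incl A).norm
    (continuous_const.mul (GraphSpace.continuous_op A).norm)) (hD v)

theorem mem_schrodingerGraph (hΩ : IsOpen Ω) (v : V ν T Ω) :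
    (GraphSpace.incl _ v, S ν T Ω v) ∈ schrodingerGraph ν T Ω := by
  rw [← schrodinger_graph_eq ν T hΩ]
  exact (schrodinger ν T Ω).mem_graph v

theorem exists_of_mem_schrodingerGraph (hΩ : IsOpen Ω) {v g : L2 T Ω}
    (h : (v, g) ∈ schrodingerGraph ν T Ω) :
    ∃ u : V ν T Ω, GraphSpace.incl _ u = v ∧ S ν T Ω u = g := by
  rw [← schrodinger_graph_eq ν T hΩ] at h
  obtain ⟨u, h1, h2⟩ := (LinearPMap.mem_graph_iff _).1 h
  exact ⟨u, h1, h2⟩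

theorem isClosed_schrodingerGraph (ν T : ℝ) (Ω : Set (EuclideanSpace ℝ (Fin d))) :
    IsClosed (schrodingerGraph ν T Ω : Set (L2 T Ω × L2 T Ω)) := by
  have h1 : IsClosed {z : L2 T Ω × L2 T Ω | IsWeakS ν T Ω z.1 z.2} := by
    simp only [IsWeakS, ofPred_forall]
    refine isClosed_iInter fun χ => isClosed_iInter fun hχ => isClosed_iInter fun _ => ?_
    simp_rw [integral_mul_eq_inner (smoothSTranspose_mem ν hχ), integral_mul_eq_inner hχ]
    exact isClosed_eq (continuous_const.inner continuous_fst)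
      (continuous_const.inner continuous_snd)
  have h2 : IsClosed {z : L2 T Ω × L2 T Ω | BoundaryCondition ν T Ω z.1 z.2} := by
    simp only [BoundaryCondition, ofPred_forall]
    refine isClosed_iInter fun ψ => isClosed_iInter fun hψ => ?_
    simp_rw [integral_mul_conj_eq_inner (smoothS_mem ν hψ.1), integral_mul_conj_eq_inner hψ.1]
    exact isClosed_eq ((continuous_fst.inner continuous_const).sub
      (continuous_snd.inner continuous_const)) continuous_const
  exact h1.inter h2

theorem restrictL2_mem_schrodingerGraph (hχ : χ ∈ SmoothCompact d)
    (hs : tsupport χ ⊆ cylinder T Ω) :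
    (restrictL2 T Ω hχ, restrictL2 T Ω (smoothS_mem ν hχ)) ∈ schrodingerGraph ν T Ω := by
  refine ⟨isWeakS_of_ae_eq hχ (coeFn_restrictL2 hχ), fun ψ hψ => sub_eq_zero.2 ?_⟩
  have e1 : ∫ p in cylinder T Ω, smoothS ν ψ p * conj (restrictL2 T Ω hχ p) =
      ∫ p in cylinder T Ω, smoothS ν ψ p * conj (χ p) :=
    integral_congr_ae ((coeFn_restrictL2 hχ).mono fun p hp => by simp only [hp])
  have e2 : ∫ p in cylinder T Ω, ψ p * conj (restrictL2 T Ω (smoothS_mem ν hχ) p) =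
      ∫ p in cylinder T Ω, ψ p * conj (smoothS ν χ p) :=
    integral_congr_ae
      ((coeFn_restrictL2 (smoothS_mem ν hχ)).mono fun p hp => by simp only [hp])
  exact e1.trans ((setIntegral_mul_conj_smoothS hψ.1 hχ hs).symm.trans e2.symm)

/-- `S` is densely defined, since its domain contains `C₀^∞(Q)`. -/
theorem dense_domain_schrodinger (ν T : ℝ) (hΩ : IsOpen Ω) :
    Dense ((schrodinger ν T Ω).domain : Set (L2 T Ω)) := by
  rw [Submodule.dense_iff_topologicalClosure_eq_top, Submodule.topologicalClosure_eq_top_iff,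
    Submodule.eq_bot_iff]
  intro z hz
  refine eq_zero_of_integral_mul_eq_zero hΩ fun χ hχ hs => ?_
  rw [integral_mul_eq_inner hχ]
  obtain ⟨u, hu, -⟩ := exists_of_mem_schrodingerGraph (ν := ν) hΩ
    (restrictL2_mem_schrodingerGraph (conj_mem hχ) ((tsupport_conj_subset χ).trans hs))
  rw [← hu]
  exact hz _ (SetLike.coe_mem (p := (schrodinger ν T Ω).domain) u)

/-- The adjoint `S*` acts as the distribution `S`. -/
theorem isWeakS_adjoint (hΩ : IsOpen Ω) (w : VAdj ν T Ω) :
    IsWeakS ν T Ω (GraphSpace.incl _ w) (GraphSpace.op _ w) := by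
  intro χ hχ hs
  obtain ⟨u, hu, hSu⟩ := exists_of_mem_schrodingerGraph (ν := ν) hΩ
    (restrictL2_mem_schrodingerGraph (conj_mem hχ) ((tsupport_conj_subset χ).trans hs))
  have h : inner ℂ (GraphSpace.op _ w) (GraphSpace.incl _ u) =
      inner ℂ (GraphSpace.incl _ w) (S ν T Ω u) :=
    (schrodinger ν T Ω).adjoint_isFormalAdjoint (dense_domain_schrodinger ν T hΩ) w u
  rw [hu, hSu] at h
  rw [integral_mul_eq_inner hχ, ← inner_conj_symm, h, inner_conj_symm, inner_eq_integral]
  refine integral_congr_ae ?_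
  filter_upwards [coeFn_restrictL2 (T := T) (Ω := Ω) (smoothS_mem ν (conj_mem hχ))] with p hp
  rw [hp, smoothS_conj, Complex.conj_conj]

/-- The a priori estimate on `𝒱`. -/
theorem norm_incl_le_S (hΩ : IsOpen Ω) (hb : Bornology.IsBounded Ω) (hT : 0 ≤ T)
    (hD : Dense (restrictions (schrodinger ν T Ω) (D₀ T Ω))) (v : V ν T Ω) :
    ‖GraphSpace.incl _ v‖ ≤ 2 * T * ‖S ν T Ω v‖ := by
  refine GraphSpace.norm_incl_le_of_dense hD (fun v hv => ?_) v
  obtain ⟨φ, hφ, hvφ⟩ := hv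
  exact norm_le_of_mem_D₀ hΩ hb hT hφ hvφ
    ((mem_schrodingerGraph hΩ v).1.ae_eq_smoothS hΩ hφ.1 hvφ)

/-- The a priori estimate on `𝒱*`. -/
theorem norm_incl_le_adjoint (hΩ : IsOpen Ω) (hb : Bornology.IsBounded Ω) (hT : 0 ≤ T)
    (hD : Dense (restrictions (schrodinger ν T Ω).adjoint (D_T T Ω))) (w : VAdj ν T Ω) :
    ‖GraphSpace.incl _ w‖ ≤ 2 * T * ‖GraphSpace.op _ w‖ := by
  refine GraphSpace.norm_incl_le_of_dense hD (fun w hw => ?_) w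
  obtain ⟨ψ, hψ, hwψ⟩ := hw
  exact norm_le_of_mem_D_T hΩ hb hT hψ hwψ
    ((isWeakS_adjoint hΩ w).ae_eq_smoothS hΩ hψ.1 hwψ)

theorem S_injective (hΩ : IsOpen Ω) (hb : Bornology.IsBounded Ω) (hT : 0 ≤ T)
    (hD : Dense (restrictions (schrodinger ν T Ω) (D₀ T Ω))) :
    Function.Injective (S ν T Ω) := by
  refine (injective_iff_map_eq_zero _).2 fun v hv => Subtype.ext ?_
  have h := norm_incl_le_S hΩ hb hT hD v
  rw [hv, norm_zero, mul_zero] at h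
  exact norm_le_zero_iff.1 h

/-- The range of `S` is closed, by the a priori estimate and the closedness of the graph. -/
theorem isClosed_range_S (hΩ : IsOpen Ω) (hb : Bornology.IsBounded Ω) (hT : 0 ≤ T)
    (hD : Dense (restrictions (schrodinger ν T Ω) (D₀ T Ω))) :
    IsClosed (LinearMap.range (S ν T Ω) : Set (L2 T Ω)) := by
  let G := schrodingerGraph ν T Ω
  have : CompleteSpace G := (isClosed_schrodingerGraph ν T Ω).completeSpace_coe
  let f : G →L[ℂ] L2 T Ω := (ContinuousLinearMap.snd ℂ _ _).comp G.subtypeL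
  have hf : AntilipschitzWith (Real.toNNReal (2 * T + 1)) f := by
    refine ContinuousLinearMap.antilipschitz_of_bound f fun z => ?_
    obtain ⟨u, h1, h2⟩ := exists_of_mem_schrodingerGraph hΩ z.2
    have h := norm_incl_le_S hΩ hb hT hD u
    rw [h1, h2] at h
    rw [Real.coe_toNNReal _ (by linarith)]
    change max ‖z.1.1‖ ‖z.1.2‖ ≤ (2 * T + 1) * ‖z.1.2‖
    have h0 := norm_nonneg z.1.2
    refine max_le (by linarith) ?_
    nlinarith
  have e : (LinearMap.range (S ν T Ω) : Set (L2 T Ω)) = range f := by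
    ext g
    constructor
    · rintro ⟨v, rfl⟩
      exact ⟨⟨_, mem_schrodingerGraph hΩ v⟩, rfl⟩
    · rintro ⟨z, rfl⟩
      obtain ⟨u, -, h2⟩ := exists_of_mem_schrodingerGraph hΩ z.2
      exact ⟨u, h2⟩
  rw [e]
  exact hf.isClosed_range f.uniformContinuous

/-- The orthogonal complement of the range of `S` is the kernel of `S*`, which is trivial. -/
theorem S_surjective (hΩ : IsOpen Ω) (hb : Bornology.IsBounded Ω) (hT : 0 ≤ T)
    (hD : DensityAssumption ν T Ω) : Function.Surjective (S ν T Ω) := by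
  -- If `w` is orthogonal to the range, then `S* w = 0`, and the estimate on `𝒱*` gives `w = 0`.
  let K : Submodule ℂ (L2 T Ω) := LinearMap.range (S ν T Ω)
  have hK : IsClosed (K : Set (L2 T Ω)) := isClosed_range_S hΩ hb hT hD.1
  have : CompleteSpace K := hK.completeSpace_coe
  refine LinearMap.range_eq_top.1 (K.orthogonal_eq_bot_iff.1 ?_)
  refine (Submodule.eq_bot_iff _).2 fun w hw => ?_
  have h0 : ∀ v : (schrodinger ν T Ω).domain,
      inner ℂ (0 : L2 T Ω) (v : L2 T Ω) = inner ℂ w (schrodinger ν T Ω v) := by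
    intro v
    rw [inner_zero_left]
    exact ((K.mem_orthogonal' w).1 hw _ ⟨v, rfl⟩).symm
  let w' : VAdj ν T Ω := ⟨w, LinearPMap.mem_adjoint_domain_of_exists w ⟨0, h0⟩⟩
  have hw' : GraphSpace.op _ w' = 0 :=
    LinearPMap.adjoint_apply_eq (dense_domain_schrodinger ν T hΩ) w' h0
  have h := norm_incl_le_adjoint hΩ hb hT hD.2 w'
  rw [hw', norm_zero, mul_zero] at h
  exact norm_le_zero_iff.1 h

/-- Testing with all of `L²(Q)` identifies `S u` with the datum. -/
theorem isVariationalSolution_iff (f : L2 T Ω) (u : V ν T Ω) :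
    IsVariationalSolution ν T Ω f u ↔ S ν T Ω u = f :=
  ⟨fun h => ext_inner_left ℂ h, fun h w => by rw [formA, h, formF]⟩

end Operator

end SchrodingerST

theorem mainTheorem3 (d : ℕ) (Ω : Set (EuclideanSpace ℝ (Fin d))) (hΩ : IsOpen Ω)
    (hb : Bornology.IsBounded Ω) (T ν : ℝ) (hT : 0 < T) (hν : 0 < ν)
    (hdense : SchrodingerST.DensityAssumption ν T Ω) :
    (Continuous (SchrodingerST.S ν T Ω) ∧ Function.Bijective (SchrodingerST.S ν T Ω)) ∧
      SchrodingerST.WellPosed ν T Ω := by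
  have hbij : Function.Bijective (SchrodingerST.S ν T Ω) :=
    ⟨SchrodingerST.S_injective hΩ hb hT.le hdense.1, SchrodingerST.S_surjective hΩ hb hT.le hdense⟩
  refine ⟨⟨SchrodingerST.GraphSpace.continuous_op _, hbij⟩, fun f => ?_, 2 * T + 1,
    fun f u hu => ?_⟩
  · simp_rw [SchrodingerST.isVariationalSolution_iff]
    exact hbij.existsUnique f
  · rw [SchrodingerST.isVariationalSolution_iff] at hu
    have h1 := SchrodingerST.norm_incl_le_S hΩ hb hT.le hdense.1 u
    have h2 := SchrodingerST.GraphSpace.norm_sq_eq _ u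
    change _ = _ + ‖SchrodingerST.S ν T Ω u‖ ^ 2 at h2
    rw [hu] at h1 h2
    have h3 := norm_nonneg f
    refine abs_le_of_sq_le_sq' ?_ (by positivity) |>.2
    rw [h2]
    have h4 := pow_le_pow_left₀ (norm_nonneg _) h1 2
    nlinarith [mul_nonneg hT.le (mul_nonneg h3 h3)]
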